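/- Fix $h>0$. There are a function $r:\mathbb{R}\to\mathbb{R}$ with $r(s)\to 0$ as $s\to 0^+$ and a number $\delta>0$, both depending only on $h$, such that the following holds. Let $M$ be a complete connected Riemannian manifold, of any dimension, with volume entropy $h$; that is, $$\lim_{R\to\infty}\frac{\log \operatorname{vol} B(\tilde x,R)}{R}=h,$$ where $B(\tilde x,R)$ is the ball of radius $R$ around a point $\tilde x$ of the universal cover $\widetilde M$ of $M$, and distance and Riemannian volume on $\widetilde M$ are those of the pulled-back metric. Let $c_1,c_2$ be two piecewise $C^1$ loops based at a point $x\in M$ which are homotopically independent, i.e. whose homotopy classes generate a free subgroup of rank $2$ of $\pi_1(M,x)$. If $\ell(c_1)<\delta$, then $$\ell(c_2)\ \geq\ \frac1h\,\log\left(\frac{4}{h\,\ell(c_1)}\right)+r(\ell(c_1)),$$ where $\ell$ denotes Riemannian length. In other words, $\ell(c_2)\geq \frac1h\log\left(\frac{4}{h\ell(c_1)}\right)+o(1)$ as $\ell(c_1)\to 0$, where the term $o(1)$ depends only on $h$ and $\ell(c_1)$. -/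

import Mathlib

open Set Filter Topology MeasureTheory Manifold Bundle Asymptotics
open scoped ENNReal ContDiff

universe u

noncomputable section

/-- The Gram determinant density of a Riemannian metric `g` in a chart `φ`: the function
`y ↦ √(det (g_ij(y)))`, where `g_ij(y) = g(∂_i, ∂_j)` and `∂_i` is the `i`-th coordinate vector
field of the chart, at the point `φ⁻¹(y)`. -/
def riemannianDensity {n : ℕ} {M : Type u} [TopologicalSpace M]
    [ChartedSpace (EuclideanSpace ℝ (Fin n)) M]
    [RiemannianBundle (fun x : M => TangentSpace (𝓡 n) x)]
    (φ : OpenPartialHomeomorph M (EuclideanSpace ℝ (Fin n)))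
    (y : EuclideanSpace ℝ (Fin n)) : ℝ :=
  Real.sqrt (Matrix.det (Matrix.of fun i j : Fin n =>
    inner ℝ
      (mfderiv (𝓡 n) (𝓡 n) φ.symm y (EuclideanSpace.single i (1 : ℝ)) :
        TangentSpace (𝓡 n) (φ.symm y))
      (mfderiv (𝓡 n) (𝓡 n) φ.symm y (EuclideanSpace.single j (1 : ℝ)) :
        TangentSpace (𝓡 n) (φ.symm y))))

/-- The measure on the domain of a chart `φ` that reads `√(det (g_ij)) dy` in the coordinates
of `φ`, extended by zero to `M`. -/
def chartVolume {n : ℕ} {M : Type u} [TopologicalSpace M] [MeasurableSpace M]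
    [ChartedSpace (EuclideanSpace ℝ (Fin n)) M]
    [RiemannianBundle (fun x : M => TangentSpace (𝓡 n) x)]
    (φ : OpenPartialHomeomorph M (EuclideanSpace ℝ (Fin n))) : Measure M :=
  Measure.map φ.symm
    ((volume.restrict φ.target).withDensity
      fun y => ENNReal.ofReal (riemannianDensity φ y))

/-- The Riemannian volume. It is the measure whose restriction to the domain of every smooth
chart `φ` is `chartVolume φ`. As these agree on overlaps, it is the least measure on `M`
which dominates all of them, i.e. their supremum in the lattice of measures. -/
def riemannianVolume (n : ℕ) (M : Type u) [TopologicalSpace M] [MeasurableSpace M]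
    [ChartedSpace (EuclideanSpace ℝ (Fin n)) M]
    [RiemannianBundle (fun x : M => TangentSpace (𝓡 n) x)] : Measure M :=
  ⨆ φ ∈ IsManifold.maximalAtlas (𝓡 n) ∞ M, chartVolume φ

/-- `p : N → M` is a Riemannian universal covering: `N` is simply connected, `p` is a smooth
covering map, and the metric of `N` is the pull-back of the metric of `M`. -/
structure IsRiemannianUniversalCovering (n : ℕ) {N M : Type u}
    [TopologicalSpace N] [ChartedSpace (EuclideanSpace ℝ (Fin n)) N]
    [RiemannianBundle (fun x : N => TangentSpace (𝓡 n) x)]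
    [TopologicalSpace M] [ChartedSpace (EuclideanSpace ℝ (Fin n)) M]
    [RiemannianBundle (fun x : M => TangentSpace (𝓡 n) x)]
    (p : N → M) : Prop where
  simplyConnected : SimplyConnectedSpace N
  isCoveringMap : IsCoveringMap p
  isLocalDiffeomorph : IsLocalDiffeomorph (𝓡 n) (𝓡 n) ∞ p
  inner_mfderiv : ∀ (x : N) (v w : TangentSpace (𝓡 n) x),
    inner ℝ (mfderiv (𝓡 n) (𝓡 n) p x v : TangentSpace (𝓡 n) (p x))
      (mfderiv (𝓡 n) (𝓡 n) p x w : TangentSpace (𝓡 n) (p x)) = inner ℝ v w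

/-- The Riemannian manifold `M` has volume entropy `h`: the volume of the ball of radius `R`
around a point `y` of the universal cover `N` of `M`, with the pulled-back metric, satisfies
`log (vol B(y, R)) / R → h` as `R → ∞`. The universal cover is unique up to isometry over `M`
and the limit does not depend on the point, so that it does not matter how `N`, `p`
and `y` are quantified. -/
def HasVolumeEntropy (n : ℕ) (M : Type u) [TopologicalSpace M]
    [ChartedSpace (EuclideanSpace ℝ (Fin n)) M]
    [RiemannianBundle (fun x : M => TangentSpace (𝓡 n) x)] (h : ℝ) : Prop :=
  ∃ (N : Type u) (_ : MetricSpace N) (_ : MeasurableSpace N) (_ : BorelSpace N)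
    (_ : ChartedSpace (EuclideanSpace ℝ (Fin n)) N) (_ : IsManifold (𝓡 n) ∞ N)
    (_ : RiemannianBundle (fun x : N => TangentSpace (𝓡 n) x))
    (_ : IsContMDiffRiemannianBundle (𝓡 n) ∞ (EuclideanSpace ℝ (Fin n))
      (fun x : N => TangentSpace (𝓡 n) x))
    (_ : IsRiemannianManifold (𝓡 n) N) (p : N → M) (y : N),
    IsRiemannianUniversalCovering n p ∧
      Tendsto (fun R : ℝ => Real.log (riemannianVolume n N (Metric.ball y R)).toReal / R)
        atTop (𝓝 h)

/-- A path in a manifold is piecewise `C^1` if there is a partition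
`0 = t 0 ≤ t 1 ≤ … ≤ t m = 1` such that it is `C^1` on every `[t i, t (i + 1)]`. -/
def IsPiecewiseC1 {n : ℕ} {M : Type u} [TopologicalSpace M]
    [ChartedSpace (EuclideanSpace ℝ (Fin n)) M] {x y : M} (c : Path x y) : Prop :=
  ∃ (m : ℕ) (t : ℕ → ℝ), Monotone t ∧ t 0 = 0 ∧ t m = 1 ∧
    ∀ i < m, ContMDiffOn 𝓘(ℝ, ℝ) (𝓡 n) 1 c.extend (Icc (t i) (t (i + 1)))

/-- The Riemannian length `∫₀¹ ‖c'(t)‖ dt` of a piecewise `C^1` path `c`. -/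
def riemannianLength (n : ℕ) {M : Type u} [TopologicalSpace M]
    [ChartedSpace (EuclideanSpace ℝ (Fin n)) M]
    [RiemannianBundle (fun x : M => TangentSpace (𝓡 n) x)] {x y : M} (c : Path x y) : ℝ≥0∞ :=
  pathELength (𝓡 n) c.extend 0 1

/-- The loops `c 0, …, c (k - 1)` based at `x` are homotopically independent: their homotopy
classes generate a subgroup of the fundamental group which is free of rank `k`. -/
def HomotopicallyIndependent {X : Type u} [TopologicalSpace X] {x : X} {k : ℕ}
    (c : Fin k → Path x x) : Prop :=
  Nonempty (Subgroup.closure (range fun i : Fin k =>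
    (FundamentalGroup.fromPath (Path.Homotopic.Quotient.mk (c i)) : FundamentalGroup X x)) ≃*
      FreeGroup (Fin k))

end

/-!
Let `ℓ₁`, `ℓ₂` be the lengths of the two loops. The idea is to compare the growth of the free group
which they generate with the volume growth of the universal covering `N`.

The fundamental group acts freely on the fibre over `x` by monodromy, since `N` is simply connected
(`IsCoveringMap.eq_one_of_monodromy_eq`), and a loop moves every point of the fibre by at most its
length (`IsRiemannianUniversalCovering.edist_le_riemannianLength`). Each point of the fibre has a
sheet over a fixed small set in `M` around it. The sheets are disjoint and have the same positive
volume, so that the number of points of the fibre in a ball is bounded by a constant times the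
volume of a slightly larger ball (`IsRiemannianUniversalCovering.exists_volume_ball_ge`). Hence the
number of points of the orbit of a base point at distance at most `R` is `O(e ^ (s R))` for every
`s > h`.

On the other hand, two elements which generate a free group of rank two are free generators, because
free groups of finite rank are Hopfian (`FreeGroup.lift_injective_of_closure_equiv`). Thus the
products `a ^ i₁ * b ^ j₁ * ⋯ * a ^ iₖ * b ^ jₖ` with non-zero exponents give distinct points of the
orbit, and weighing them by `e ^ (-s · length)` shows that
`(∑ i ≠ 0, e ^ (-s |i| ℓ₁)) * (∑ j ≠ 0, e ^ (-s |j| ℓ₂)) ≤ 1` for `s > h`, hence for `s = h`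
(`four_le_of_orbit_growth`). Summing the geometric series, this says that
`4 ≤ (e ^ (h ℓ₁) - 1) * (e ^ (h ℓ₂) - 1)` (`HasVolumeEntropy.four_le`), i.e.
`log (1 + 4 / (e ^ (h ℓ₁) - 1)) / h ≤ ℓ₂`. The left hand side is `log (4 / (h ℓ₁)) / h + o(1)`.
-/

/-! ### Free groups -/

/-- A partial injection of a finite set into itself extends to a permutation. -/
theorem exists_perm_of_biUnique {V : Type*} [Finite V] {R : V → V → Prop}
    (hR : Relator.BiUnique R) : ∃ σ : Equiv.Perm V, ∀ x y, R x y → σ x = y := by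
  classical
  have := Fintype.ofFinite V
  choose f hf using fun x : {x // ∃ y, R x y} => x.2
  choose g hg using fun y : {y // ∃ x, R x y} => y.2
  let e : {x // ∃ y, R x y} ≃ {y // ∃ x, R x y} :=
    { toFun x := ⟨f x, x, hf x⟩
      invFun y := ⟨g y, y, hg y⟩
      left_inv x := Subtype.ext (hR.1 (hg _) (hf x))
      right_inv y := Subtype.ext (hR.2 (hf _) (hg y)) }
  refine ⟨e.extendSubtype, fun x y h => ?_⟩
  rw [e.extendSubtype_apply_of_mem x ⟨y, h⟩]
  exact hR.2 (hf _) h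

/-- Free groups are residually finite. The reduced word `L` of `g` is spelled out along the points
`0, 1, …, L.length`; reducedness says that the letters with a given underlying generator prescribe
a partial injection of these points, and any extensions to permutations carry the last point
to `0` under `g`. -/
theorem FreeGroup.exists_hom_perm_ne_one {α : Type*} {g : FreeGroup α} (hg : g ≠ 1) :
    ∃ (n : ℕ) (f : FreeGroup α →* Equiv.Perm (Fin n)), f g ≠ 1 := by
  classical
  set L := g.toWord with hL
  have hred : FreeGroup.IsReduced L := FreeGroup.isReduced_toWord
  have hstep : ∀ i (h : i + 1 < L.length), (L[i]).1 = (L[i + 1]).1 → (L[i]).2 = (L[i + 1]).2 :=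
    fun i h => List.isChain_iff_getElem.1 hred i h
  -- The letter at position `i` sends the point `i + 1` to `i`.
  let R : α → Fin (L.length + 1) → Fin (L.length + 1) → Prop := fun a x y =>
    (∃ h : y.1 < L.length, L[y.1] = (a, true) ∧ x.1 = y.1 + 1) ∨
      (∃ h : x.1 < L.length, L[x.1] = (a, false) ∧ y.1 = x.1 + 1)
  have hR : ∀ a, Relator.BiUnique (R a) := by
    intro a
    constructor
    · rintro x x' y (⟨h, e, hx⟩ | ⟨h, e, hx⟩) (⟨h', e', hx'⟩ | ⟨h', e', hx'⟩)
      · ext; omega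
      · have := hstep x'.1 (by omega)
        simp only [← hx', e, e'] at this
        simp at this
      · have := hstep x.1 (by omega)
        simp only [← hx, e, e'] at this
        simp at this
      · ext; omega
    · rintro x y y' (⟨h, e, hx⟩ | ⟨h, e, hx⟩) (⟨h', e', hx'⟩ | ⟨h', e', hx'⟩)
      · ext; omega
      · have := hstep y.1 (by omega)
        simp only [← hx, e, e'] at this
        simp at this
      · have := hstep y'.1 (by omega)
        simp only [← hx', e, e'] at this
        simp at this
      · ext; omega
  choose σ hσ using fun a => exists_perm_of_biUnique (hR a)
  refine ⟨L.length + 1, FreeGroup.lift σ, fun h1 => ?_⟩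
  have key : ∀ k (hk : k ≤ L.length),
      FreeGroup.lift σ (FreeGroup.mk (L.drop (L.length - k))) (Fin.last _) =
        ⟨L.length - k, by omega⟩ := by
    intro k
    induction k with
    | zero =>
      intro _
      have : L.drop (L.length - 0) = [] := by simp
      rw [this, FreeGroup.lift_mk]
      simp [Fin.last]
    | succ k ih =>
      intro hk
      have hlt : L.length - (k + 1) < L.length := by omega
      have hs : L.length - (k + 1) + 1 = L.length - k := by omega
      have ih' := ih (by omega)
      rw [FreeGroup.lift_mk] at ih' ⊢
      rw [List.drop_eq_getElem_cons hlt, List.map_cons, List.prod_cons, hs,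
        Equiv.Perm.mul_apply, ih']
      rcases hb : L[L.length - (k + 1)] with ⟨a, _ | _⟩
      · simp only [cond_false]
        rw [Equiv.Perm.inv_eq_iff_eq]
        exact (hσ a _ _ (Or.inr ⟨hlt, hb, hs.symm⟩)).symm
      · simp only [cond_true]
        exact hσ a _ _ (Or.inl ⟨hlt, hb, hs.symm⟩)
  have h0 := key L.length le_rfl
  simp only [Nat.sub_self, List.drop_zero] at h0
  have hmk : FreeGroup.mk L = g := FreeGroup.mk_toWord
  rw [hmk, h1] at h0
  have hlen : L.length = 0 := by simpa using congrArg Fin.val h0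
  exact hg (FreeGroup.toWord_eq_nil_iff.1 (List.length_eq_zero_iff.1 hlen))

/-- Free groups of finite rank are Hopfian. For a finite group `Q`, precomposition with a surjective
endomorphism is an injective, hence surjective, self-map of the finite set of homomorphisms to `Q`,
so that all of these vanish on its kernel. -/
theorem FreeGroup.injective_of_surjective {α : Type*} [Finite α] (f : FreeGroup α →* FreeGroup α)
    (hf : Function.Surjective f) : Function.Injective f := by
  rw [injective_iff_map_eq_one]
  intro g hg
  by_contra hne
  obtain ⟨n, φ, hφ⟩ := FreeGroup.exists_hom_perm_ne_one hne
  have : Finite (FreeGroup α →* Equiv.Perm (Fin n)) := Finite.of_equiv _ FreeGroup.lift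
  have hinj : Function.Injective fun ψ : FreeGroup α →* Equiv.Perm (Fin n) => ψ.comp f :=
    fun _ _ h => MonoidHom.cancel_right hf |>.1 h
  obtain ⟨ψ, rfl⟩ := (Finite.injective_iff_surjective.1 hinj) φ
  exact hφ (by simp [hg])

/-- If finitely many elements generate a subgroup which is free of the same rank, then they are a
free basis of it: this is the Hopf property. -/
theorem FreeGroup.lift_injective_of_closure_equiv {ι G : Type*} [Finite ι] [Group G] (c : ι → G)
    (e : Subgroup.closure (range c) ≃* FreeGroup ι) :
    Function.Injective (FreeGroup.lift c) := by
  let f : FreeGroup ι →* Subgroup.closure (range c) :=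
    FreeGroup.lift fun i => ⟨c i, Subgroup.subset_closure ⟨i, rfl⟩⟩
  have hcomp : (Subgroup.subtype _).comp f = FreeGroup.lift c := by
    ext i; simp [f]
  have hsurj : Function.Surjective f := by
    rintro ⟨g, hg⟩
    have : g ∈ (FreeGroup.lift c).range := by rwa [FreeGroup.range_lift_eq_closure]
    obtain ⟨w, rfl⟩ := this
    exact ⟨w, Subtype.ext (DFunLike.congr_fun hcomp w)⟩
  have hinj : Function.Injective (e.toMonoidHom.comp f) :=
    FreeGroup.injective_of_surjective _ (e.surjective.comp hsurj)
  rw [← hcomp]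
  exact Subtype.val_injective.comp (Function.Injective.of_comp (f := e) hinj)

/-- In a free group on `a`, `b`, the products `a ^ i₁ * b ^ j₁ * ⋯ * a ^ iₖ * b ^ jₖ` with non-zero
exponents are pairwise distinct. They map to reduced words in the free product of two copies
of `ℤ`. -/
theorem FreeGroup.alternating_prod_injective {G : Type*} [Group G] {c : Fin 2 → G}
    (hc : Function.Injective (FreeGroup.lift c)) {l l' : List (ℤ × ℤ)}
    (hl : ∀ q ∈ l, q.1 ≠ 0 ∧ q.2 ≠ 0) (hl' : ∀ q ∈ l', q.1 ≠ 0 ∧ q.2 ≠ 0)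
    (h : (l.map fun q => c 0 ^ q.1 * c 1 ^ q.2).prod =
      (l'.map fun q => c 0 ^ q.1 * c 1 ^ q.2).prod) : l = l' := by
  let M : Fin 2 → Type := fun _ => Multiplicative ℤ
  let ψ : FreeGroup (Fin 2) →* Monoid.CoprodI M :=
    FreeGroup.lift fun i => Monoid.CoprodI.of (M := M) (i := i) (Multiplicative.ofAdd 1)
  let s : ℤ × ℤ → List (Σ i, M i) :=
    fun q => [⟨0, Multiplicative.ofAdd q.1⟩, ⟨1, Multiplicative.ofAdd q.2⟩]
  have hchain : ∀ l : List (ℤ × ℤ), (l.flatMap s).IsChain (fun a b => a.1 ≠ b.1) := by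
    intro l
    induction l with
    | nil => simp
    | cons q l ih =>
      cases l with
      | nil => simp [s]
      | cons q' l => simpa [s] using ih
  let W : ∀ l : List (ℤ × ℤ), (∀ q ∈ l, q.1 ≠ 0 ∧ q.2 ≠ 0) → Monoid.CoprodI.Word M :=
    fun l hl => ⟨l.flatMap s, by
      intro a ha
      obtain ⟨q, hq, ha⟩ := List.mem_flatMap.1 ha
      have := hl q hq
      simp only [s, List.mem_cons, List.not_mem_nil, or_false] at ha
      rcases ha with rfl | rfl
      · exact fun h0 => this.1 (Multiplicative.ofAdd.injective h0)
      · exact fun h0 => this.2 (Multiplicative.ofAdd.injective h0), hchain l⟩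
  let w : List (ℤ × ℤ) → FreeGroup (Fin 2) := fun l =>
    (l.map fun q => FreeGroup.of 0 ^ q.1 * FreeGroup.of 1 ^ q.2).prod
  have hw : ∀ l, FreeGroup.lift c (w l) = (l.map fun q => c 0 ^ q.1 * c 1 ^ q.2).prod := by
    intro l
    simp [w, map_list_prod, Function.comp_def]
  have hW : ∀ l hl, (W l hl).prod = ψ (w l) := by
    intro l hl
    have hpow : ∀ (i : Fin 2) (n : ℤ), ψ (FreeGroup.of i) ^ n =
        Monoid.CoprodI.of (M := M) (i := i) (Multiplicative.ofAdd n) := by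
      intro i n
      simp only [ψ, FreeGroup.lift_apply_of]
      rw [← map_zpow, ← ofAdd_zsmul]
      simp
    induction l with
    | nil => simp [W, w, Monoid.CoprodI.Word.prod]
    | cons q l ih =>
      have ih' := ih (fun q' hq' => hl q' (List.mem_cons_of_mem _ hq'))
      simp only [W, w, Monoid.CoprodI.Word.prod] at ih' ⊢
      simp only [List.flatMap_cons, List.map_append, List.prod_append, ih', List.map_cons,
        List.prod_cons]
      rw [_root_.map_mul, _root_.map_mul, map_zpow, map_zpow, hpow, hpow]
      simp [s]
  have h1 : w l = w l' := hc (by rw [hw, hw, h])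
  have h2 : W l hl = W l' hl' :=
    Monoid.CoprodI.Word.equiv.symm.injective
      (show (W l hl).prod = (W l' hl').prod by rw [hW l hl, hW l' hl', h1])
  have h3 : l.flatMap s = l'.flatMap s := congrArg Monoid.CoprodI.Word.toList h2
  clear h h1 h2 hl hl'
  induction l generalizing l' with
  | nil =>
    cases l' with
    | nil => rfl
    | cons q l' => simp [s] at h3
  | cons q l ih =>
    cases l' with
    | nil => simp [s] at h3
    | cons q' l' =>
      simp only [List.flatMap_cons, s, List.cons_append, List.nil_append, List.cons.injEq,
        Sigma.mk.injEq, heq_eq_eq, true_and] at h3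
      obtain ⟨e1, e2, e3⟩ := h3
      rw [ih e3, Prod.ext (Multiplicative.ofAdd.injective e1) (Multiplicative.ofAdd.injective e2)]

/-! ### Growth of free orbits -/

/-- If the number of words over `T` of weight at most `R` is `O(e ^ (s R))`, uniformly in the length
of the words, then `q = ∑ t ∈ T, e ^ (-s wt t)` is at most `1`. The sum of `e ^ (-s wt)` over the
words of length `k` is `q ^ k`, and it grows at most linearly in `k`: each of the unit intervals
which cover the possible weights contributes a bounded amount. -/
theorem sum_exp_neg_le_one {ι : Type*} (T : Finset ι) (wt : ι → ℝ) (h_wt : ∀ t, 0 ≤ wt t)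
    {s C : ℝ} (hs : 0 ≤ s)
    (hcount : ∀ (k : ℕ) (R : ℝ), 0 ≤ R →
      (((Fintype.piFinset fun _ : Fin k => T).filter fun w => ∑ i, wt (w i) ≤ R).card : ℝ) ≤
        C * Real.exp (s * R)) :
    ∑ t ∈ T, Real.exp (-(s * wt t)) ≤ 1 := by
  classical
  set q := ∑ t ∈ T, Real.exp (-(s * wt t)) with hq
  set L := ∑ t ∈ T, wt t with hL
  have hL0 : 0 ≤ L := Finset.sum_nonneg fun t _ => h_wt t
  have hbound : ∀ k : ℕ, q ^ k ≤ (k * L + 1) * (C * Real.exp s) := by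
    intro k
    set P := Fintype.piFinset fun _ : Fin k => T with hP
    have hwpos : ∀ w : Fin k → ι, 0 ≤ ∑ i, wt (w i) := fun w => Finset.sum_nonneg fun i _ => h_wt _
    have h1 : q ^ k = ∑ w ∈ P, Real.exp (-(s * ∑ i, wt (w i))) := by
      rw [hq, Finset.sum_pow']
      refine Finset.sum_congr rfl fun w _ => ?_
      rw [← Real.exp_sum, Finset.mul_sum, Finset.sum_neg_distrib]
    -- Sort the words by the integral part of their weight.
    have hmaps : ∀ w ∈ P, ⌊∑ i, wt (w i)⌋₊ ∈ Finset.range (⌊k * L⌋₊ + 1) := by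
      intro w hw
      rw [Finset.mem_range, Nat.lt_succ_iff]
      refine Nat.floor_le_floor ?_
      calc ∑ i, wt (w i) ≤ ∑ _i : Fin k, L := Finset.sum_le_sum fun i _ =>
            Finset.single_le_sum (fun t _ => h_wt t) (Fintype.mem_piFinset.1 hw i)
        _ = k * L := by simp
    have hC : 0 ≤ C := by
      have := (Nat.cast_nonneg _).trans (hcount 0 0 le_rfl)
      simpa using this
    rw [h1, ← Finset.sum_fiberwise_of_maps_to hmaps]
    calc ∑ m ∈ Finset.range (⌊k * L⌋₊ + 1), ∑ w ∈ P with ⌊∑ i, wt (w i)⌋₊ = m,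
          Real.exp (-(s * ∑ i, wt (w i)))
        ≤ ∑ m ∈ Finset.range (⌊k * L⌋₊ + 1), C * Real.exp s := by
          refine Finset.sum_le_sum fun m _ => ?_
          calc ∑ w ∈ P with ⌊∑ i, wt (w i)⌋₊ = m, Real.exp (-(s * ∑ i, wt (w i)))
              ≤ ∑ w ∈ P with ⌊∑ i, wt (w i)⌋₊ = m, Real.exp (-(s * m)) := by
                refine Finset.sum_le_sum fun w hw => ?_
                have hm := (Finset.mem_filter.1 hw).2
                have : (m : ℝ) ≤ ∑ i, wt (w i) := hm ▸ Nat.floor_le (hwpos w)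
                gcongr
            _ = ((P.filter fun w => ⌊∑ i, wt (w i)⌋₊ = m).card : ℝ) * Real.exp (-(s * m)) := by
                rw [Finset.sum_const, nsmul_eq_mul]
            _ ≤ (C * Real.exp (s * (m + 1))) * Real.exp (-(s * m)) := by
                gcongr
                refine le_trans ?_ (hcount k (m + 1) (by positivity))
                norm_cast
                refine Finset.card_le_card fun w hw => ?_
                obtain ⟨hw, hm⟩ := Finset.mem_filter.1 hw
                refine Finset.mem_filter.2 ⟨hw, ?_⟩
                have := (Nat.lt_floor_add_one (∑ i, wt (w i))).le
                rw [hm] at this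
                exact_mod_cast this
            _ = C * Real.exp s := by
                rw [mul_assoc, ← Real.exp_add]
                ring_nf
      _ = (⌊k * L⌋₊ + 1) * (C * Real.exp s) := by simp
      _ ≤ (k * L + 1) * (C * Real.exp s) := by
          gcongr
          exact Nat.floor_le (by positivity)
  by_contra! hlt
  have h1 := tendsto_pow_const_div_const_pow_of_one_lt 1 hlt
  have h2 := tendsto_pow_const_div_const_pow_of_one_lt 0 hlt
  have h3 : Tendsto (fun k : ℕ => (L * ((k : ℝ) ^ 1 / q ^ k) + (k : ℝ) ^ 0 / q ^ k) *
      (C * Real.exp s)) atTop (𝓝 ((L * 0 + 0) * (C * Real.exp s))) :=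
    ((h1.const_mul L).add h2).mul_const _
  have h4 : (1 : ℝ) ≤ (L * 0 + 0) * (C * Real.exp s) := by
    refine ge_of_tendsto' h3 fun k => ?_
    have hpos : 0 < q ^ k := by positivity
    have := (le_div_iff₀ hpos).2 ((one_mul (q ^ k)).le.trans (hbound k))
    refine this.trans_eq ?_
    field_simp
  norm_num at h4

/-- Summing the geometric series turns `2 (x + x² + ⋯) * 2 (y + y² + ⋯) ≤ 1` into
`4 ≤ (x⁻¹ - 1) * (y⁻¹ - 1)`. -/
theorem four_le_of_partial_sums_le {x y : ℝ} (hx : 0 < x) (hx1 : x ≤ 1) (hy : 0 < y) (hy1 : y ≤ 1)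
    (h : ∀ K : ℕ, (2 * ∑ n ∈ Finset.range K, x ^ (n + 1)) *
      (2 * ∑ n ∈ Finset.range K, y ^ (n + 1)) ≤ 1) :
    x < 1 ∧ y < 1 ∧ 4 ≤ (x⁻¹ - 1) * (y⁻¹ - 1) := by
  have aux : ∀ {x y : ℝ}, 0 < x → x ≤ 1 → 0 < y → (∀ K : ℕ,
      (2 * ∑ n ∈ Finset.range K, x ^ (n + 1)) * (2 * ∑ n ∈ Finset.range K, y ^ (n + 1)) ≤ 1) →
      x < 1 := by
    intro x y hx hx1 hy h
    refine hx1.lt_of_ne ?_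
    rintro rfl
    obtain ⟨K, hK⟩ := exists_nat_gt (y⁻¹)
    have hK0 : 0 < K := by
      have : (0 : ℝ) < K := (inv_pos.2 hy).trans hK
      exact_mod_cast this
    have h1 := h K
    have h2 : y ≤ ∑ n ∈ Finset.range K, y ^ (n + 1) := by
      have := Finset.single_le_sum (f := fun n => y ^ (n + 1)) (s := Finset.range K)
        (fun n _ => by positivity) (Finset.mem_range.2 hK0)
      simpa using this
    have h3 : 1 < K * y := by
      rwa [inv_lt_iff_one_lt_mul₀ hy] at hK
    simp only [one_pow, Finset.sum_const, Finset.card_range, nsmul_eq_mul, mul_one] at h1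
    nlinarith [mul_le_mul_of_nonneg_left h2 (Nat.cast_nonneg (α := ℝ) K)]
  have hx' := aux hx hx1 hy h
  have hy' := aux hy hy1 hx fun K => by rw [mul_comm]; exact h K
  refine ⟨hx', hy', ?_⟩
  have hsum : ∀ {x : ℝ}, 0 < x → x < 1 →
      Tendsto (fun K : ℕ => ∑ n ∈ Finset.range K, x ^ (n + 1)) atTop (𝓝 ((1 - x)⁻¹ * x)) := by
    intro x h0 h1
    have := ((hasSum_geometric_of_lt_one h0.le h1).mul_right x).tendsto_sum_nat
    simpa only [pow_succ] using this
  have hlim := le_of_tendsto'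
    (((hsum hx hx').const_mul 2).mul ((hsum hy hy').const_mul 2)) h
  have h1x : 0 < 1 - x := sub_pos.2 hx'
  have h1y : 0 < 1 - y := sub_pos.2 hy'
  have e1 : x⁻¹ - 1 = (1 - x) / x := by field_simp
  have e2 : y⁻¹ - 1 = (1 - y) / y := by field_simp
  have h4 : 4 * (x * y) ≤ (1 - x) * (1 - y) := by
    have : 2 * ((1 - x)⁻¹ * x) * (2 * ((1 - y)⁻¹ * y)) = 4 * (x * y) / ((1 - x) * (1 - y)) := by
      field_simp; ring
    rw [this, div_le_one (by positivity)] at hlim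
    exact hlim
  rw [e1, e2, div_mul_div_comm, le_div_iff₀ (by positivity)]
  exact h4

/-- Growth of a free orbit. Let `c 0`, `c 1` be free generators of a group acting on `F`, with
trivial stabilizer at `e`, and let `c i` move the position `pos z` of every point `z` by at most
`ℓ i`. If the number of points of `F` at distance at most `R` from `e` has exponential growth rate
at most `h`, then `4 ≤ (e ^ (h ℓ₀) - 1) * (e ^ (h ℓ₁) - 1)`. The products of the elements
`c 0 ^ i * c 1 ^ j`, with `i` and `j` non-zero, give distinct points of the orbit, so that the sum
of `e ^ (-s (|i| ℓ₀ + |j| ℓ₁))` over all `i`, `j` is at most `1` for all `s > h`. -/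
theorem four_le_of_orbit_growth {G F : Type*} [Group G] [MulAction G F] {X : Type*}
    [PseudoMetricSpace X] (pos : F → X) {c : Fin 2 → G}
    (hc : Function.Injective (FreeGroup.lift c)) {e : F} (he : ∀ g : G, g • e = e → g = 1)
    {ℓ : Fin 2 → ℝ} (hℓ : ∀ i z, dist (pos z) (pos (c i • z)) ≤ ℓ i) {h : ℝ} (hh : 0 ≤ h)
    (hgrowth : ∀ s > h, ∃ C : ℝ, ∀ (R : ℝ) (S : Finset F), 0 ≤ R →
      (∀ z ∈ S, dist (pos e) (pos z) ≤ R) → (S.card : ℝ) ≤ C * Real.exp (s * R)) :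
    Real.exp (-(h * ℓ 0)) < 1 ∧ Real.exp (-(h * ℓ 1)) < 1 ∧
      4 ≤ (Real.exp (h * ℓ 0) - 1) * (Real.exp (h * ℓ 1) - 1) := by
  classical
  have hℓ0 : ∀ i, 0 ≤ ℓ i := fun i => dist_nonneg.trans (hℓ i e)
  -- The non-zero integers are parametrized by a sign and the predecessor of the absolute value.
  let sg : Bool × ℕ → ℤ := fun p => if p.1 then (p.2 + 1 : ℤ) else -(p.2 + 1 : ℤ)
  have hsg0 : ∀ p, sg p ≠ 0 := by
    rintro ⟨_ | _, n⟩ <;> simp [sg] <;> omega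
  have hsg_inj : Function.Injective sg := by
    rintro ⟨_ | _, n⟩ ⟨_ | _, m⟩ h <;> simp [sg] at h ⊢ <;> omega
  have hsg_abs : ∀ p, (sg p).natAbs = p.2 + 1 := by
    rintro ⟨_ | _, n⟩ <;> simp [sg] <;> omega
  have hpow : ∀ (i : Fin 2) (n : ℕ) (z : F), dist (pos z) (pos (c i ^ n • z)) ≤ n * ℓ i := by
    intro i n
    induction n with
    | zero => intro z; simp
    | succ n ih =>
      intro z
      calc dist (pos z) (pos (c i ^ (n + 1) • z))
          ≤ dist (pos z) (pos (c i ^ n • z)) + dist (pos (c i ^ n • z)) (pos (c i ^ (n + 1) • z)) :=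
            dist_triangle _ _ _
        _ ≤ n * ℓ i + ℓ i := by
            rw [pow_succ' (c i) n, mul_smul]
            exact add_le_add (ih z) (hℓ i _)
        _ = ((n + 1 : ℕ) : ℝ) * ℓ i := by push_cast; ring
  have hzpow : ∀ (i : Fin 2) (p : Bool × ℕ) (z : F),
      dist (pos z) (pos (c i ^ sg p • z)) ≤ (p.2 + 1 : ℕ) * ℓ i := by
    intro i p z
    rw [← hsg_abs p]
    rcases Int.natAbs_eq (sg p) with h | h
    · conv_lhs => rw [h, zpow_natCast]
      exact hpow _ _ _
    · conv_lhs => rw [h, zpow_neg, zpow_natCast]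
      have := hpow i (sg p).natAbs ((c i ^ (sg p).natAbs)⁻¹ • z)
      rwa [smul_inv_smul, dist_comm] at this
  let word : (Bool × ℕ) × (Bool × ℕ) → G := fun t => c 0 ^ sg t.1 * c 1 ^ sg t.2
  let wt : (Bool × ℕ) × (Bool × ℕ) → ℝ := fun t =>
    (t.1.2 + 1 : ℕ) * ℓ 0 + (t.2.2 + 1 : ℕ) * ℓ 1
  have h_wt : ∀ t, 0 ≤ wt t := fun t => by
    have := hℓ0 0; have := hℓ0 1; positivity
  have hword : ∀ t z, dist (pos z) (pos (word t • z)) ≤ wt t := by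
    intro t z
    simp only [word, mul_smul]
    refine (dist_triangle _ (pos (c 1 ^ sg t.2 • z)) _).trans ?_
    rw [add_comm]
    exact add_le_add (hzpow _ _ _) (hzpow _ _ _)
  have hlist : ∀ l : List ((Bool × ℕ) × (Bool × ℕ)),
      dist (pos e) (pos ((l.map word).prod • e)) ≤ (l.map wt).sum := by
    intro l
    induction l with
    | nil => simp
    | cons t l ih =>
      simp only [List.map_cons, List.prod_cons, List.sum_cons, mul_smul]
      refine (dist_triangle _ (pos ((l.map word).prod • e)) _).trans ?_
      rw [add_comm]
      exact add_le_add (hword _ _) ih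
  have hinj : ∀ k, Function.Injective fun w : Fin k → (Bool × ℕ) × (Bool × ℕ) =>
      ((List.ofFn w).map word).prod • e := by
    intro k w w' hww
    have h1 : ((List.ofFn w).map word).prod = ((List.ofFn w').map word).prod := by
      have := he (((List.ofFn w').map word).prod⁻¹ * ((List.ofFn w).map word).prod) (by
        rw [mul_smul]; exact inv_smul_eq_iff.2 hww)
      exact (inv_mul_eq_one.1 this).symm
    let f : (Bool × ℕ) × (Bool × ℕ) → ℤ × ℤ := Prod.map sg sg
    have h2 : ∀ l : List ((Bool × ℕ) × (Bool × ℕ)), (l.map word).prod =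
        ((l.map f).map fun q => c 0 ^ q.1 * c 1 ^ q.2).prod := by
      intro l; rw [List.map_map]; rfl
    rw [h2, h2] at h1
    have h0 : ∀ l : List ((Bool × ℕ) × (Bool × ℕ)), ∀ q ∈ l.map f, q.1 ≠ 0 ∧ q.2 ≠ 0 := by
      intro l q hq
      obtain ⟨t, -, rfl⟩ := List.mem_map.1 hq
      exact ⟨hsg0 _, hsg0 _⟩
    have h3 := FreeGroup.alternating_prod_injective hc (h0 _) (h0 _) h1
    exact List.ofFn_injective ((hsg_inj.prodMap hsg_inj).list_map h3)
  have hsum_lt : ∀ s > h, ∀ K : ℕ,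
      (2 * ∑ n ∈ Finset.range K, Real.exp (-(s * ℓ 0)) ^ (n + 1)) *
        (2 * ∑ n ∈ Finset.range K, Real.exp (-(s * ℓ 1)) ^ (n + 1)) ≤ 1 := by
    intro s hs K
    obtain ⟨C, hC⟩ := hgrowth s hs
    let T₁ : Finset (Bool × ℕ) := Finset.univ ×ˢ Finset.range K
    have h1 := sum_exp_neg_le_one (T₁ ×ˢ T₁) wt h_wt (s := s) (C := C) (hh.trans hs.le) (by
      intro k R hR
      rw [← Finset.card_image_of_injective _ (hinj k)]
      refine hC R _ hR fun z hz => ?_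
      obtain ⟨w, hw, rfl⟩ := Finset.mem_image.1 hz
      refine (hlist _).trans ?_
      have := (Finset.mem_filter.1 hw).2
      rwa [← List.sum_ofFn, ← Function.comp_def wt w, ← List.map_ofFn] at this)
    refine le_trans (le_of_eq ?_) h1
    have h2 : ∀ i : Fin 2, 2 * ∑ n ∈ Finset.range K, Real.exp (-(s * ℓ i)) ^ (n + 1) =
        ∑ p ∈ T₁, Real.exp (-(s * ((p.2 + 1 : ℕ) * ℓ i))) := by
      intro i
      have : ∀ n : ℕ, Real.exp (-(s * ((n + 1 : ℕ) * ℓ i))) =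
          Real.exp (-(s * ℓ i)) ^ (n + 1) := by
        intro n
        rw [← Real.exp_nat_mul]
        congr 1; ring
      simp only [T₁, Finset.sum_product, this]
      simp
    rw [h2, h2, Finset.sum_mul_sum, ← Finset.sum_product']
    refine Finset.sum_congr rfl fun t _ => ?_
    rw [← Real.exp_add]
    congr 1
    simp only [wt]; ring
  have hsum : ∀ K : ℕ,
      (2 * ∑ n ∈ Finset.range K, Real.exp (-(h * ℓ 0)) ^ (n + 1)) *
        (2 * ∑ n ∈ Finset.range K, Real.exp (-(h * ℓ 1)) ^ (n + 1)) ≤ 1 := by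
    intro K
    -- The inequality holds for all `s > h`; let `s` tend to `h`.
    have hcont : Continuous fun s : ℝ =>
      (2 * ∑ n ∈ Finset.range K, Real.exp (-(s * ℓ 0)) ^ (n + 1)) *
        (2 * ∑ n ∈ Finset.range K, Real.exp (-(s * ℓ 1)) ^ (n + 1)) := by fun_prop
    refine le_of_tendsto ((hcont.tendsto h).mono_left nhdsWithin_le_nhds : Tendsto _ (𝓝[>] h) _) ?_
    filter_upwards [self_mem_nhdsWithin] with s hs using hsum_lt s hs K
  have hle : ∀ i, Real.exp (-(h * ℓ i)) ≤ 1 := fun i =>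
    Real.exp_le_one_iff.2 (neg_nonpos.2 (mul_nonneg hh (hℓ0 i)))
  have := four_le_of_partial_sums_le (Real.exp_pos _) (hle 0) (Real.exp_pos _) (hle 1) hsum
  simpa only [Real.exp_neg, inv_inv] using this

/-! ### Lifts of paths and their lengths -/

/-- A continuous lift of a `C^k` map through a local diffeomorphism is `C^k`. -/
theorem IsLocalDiffeomorph.contMDiffOn_of_comp {n : ℕ} {N M : Type*}
    [TopologicalSpace N] [ChartedSpace (EuclideanSpace ℝ (Fin n)) N]
    [TopologicalSpace M] [ChartedSpace (EuclideanSpace ℝ (Fin n)) M] {p : N → M}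
    (hp : IsLocalDiffeomorph (𝓡 n) (𝓡 n) ∞ p) {E H X : Type*} [NormedAddCommGroup E]
    [NormedSpace ℝ E] [TopologicalSpace H] {I : ModelWithCorners ℝ E H} [TopologicalSpace X]
    [ChartedSpace H X] {k : ℕ∞} {f : X → N} {s : Set X}
    (hf : ContinuousOn f s) (hpf : ContMDiffOn I (𝓡 n) k (p ∘ f) s) :
    ContMDiffOn I (𝓡 n) k f s := by
  intro t ht
  obtain ⟨Φ, hΦ, hΦp⟩ := hp (f t)
  have hev : ∀ᶠ t' in 𝓝[s] t, f t' ∈ Φ.source :=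
    (hf t ht).eventually (Φ.open_source.mem_nhds hΦ)
  have hsymm : ContMDiffAt (𝓡 n) (𝓡 n) k Φ.symm ((p ∘ f) t) := by
    have h1 : ContMDiffOn (𝓡 n) (𝓡 n) ∞ Φ.symm Φ.target := Φ.contMDiffOn_invFun
    have h2 : (p ∘ f) t ∈ Φ.target := by
      rw [Function.comp_apply, hΦp hΦ]; exact Φ.map_source hΦ
    exact (h1.contMDiffAt (Φ.open_target.mem_nhds h2)).of_le (by exact_mod_cast le_top)
  have hcomp : ContMDiffWithinAt I (𝓡 n) k (Φ.symm ∘ (p ∘ f)) s t :=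
    hsymm.comp_contMDiffWithinAt t (hpf t ht)
  have hback : ∀ y ∈ Φ.source, Φ.symm (p y) = y := fun y hy => by
    rw [hΦp hy]; exact Φ.left_inv hy
  refine hcomp.congr_of_eventuallyEq ?_ (hback _ hΦ).symm
  filter_upwards [hev] with t' ht' using (hback _ ht').symm

section Lifts

variable {n : ℕ} {N M : Type u} [MetricSpace N] [ChartedSpace (EuclideanSpace ℝ (Fin n)) N]
  [RiemannianBundle (fun x : N => TangentSpace (𝓡 n) x)] [MetricSpace M]
  [ChartedSpace (EuclideanSpace ℝ (Fin n)) M]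
  [RiemannianBundle (fun x : M => TangentSpace (𝓡 n) x)] {p : N → M}

theorem IsRiemannianUniversalCovering.enorm_mfderiv (hp : IsRiemannianUniversalCovering n p)
    (x : N) (v : TangentSpace (𝓡 n) x) :
    ‖(mfderiv (𝓡 n) (𝓡 n) p x v : TangentSpace (𝓡 n) (p x))‖ₑ = ‖v‖ₑ := by
  have h := hp.inner_mfderiv x v v
  rw [real_inner_self_eq_norm_sq, real_inner_self_eq_norm_sq] at h
  rw [← ofReal_norm, ← ofReal_norm, (sq_eq_sq₀ (norm_nonneg _) (norm_nonneg _)).1 h]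

variable [IsRiemannianManifold (𝓡 n) N]

/-- A lift `γ` of a `C^1` path `c` has the same length as `c`, which therefore bounds the distance
between the endpoints of `γ`. -/
theorem IsRiemannianUniversalCovering.edist_le_pathELength
    (hp : IsRiemannianUniversalCovering n p) {γ : ℝ → N} {c : ℝ → M} {a b : ℝ} (hab : a ≤ b)
    (hγ : ContinuousOn γ (Icc a b)) (hc : ContMDiffOn 𝓘(ℝ, ℝ) (𝓡 n) 1 c (Icc a b))
    (hγc : EqOn (p ∘ γ) c (Icc a b)) :
    edist (γ a) (γ b) ≤ pathELength (𝓡 n) c a b := by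
  have hγ1 : ContMDiffOn 𝓘(ℝ, ℝ) (𝓡 n) 1 γ (Icc a b) :=
    hp.isLocalDiffeomorph.contMDiffOn_of_comp (k := 1) hγ (hc.congr hγc)
  rw [IsRiemannianManifold.out (I := 𝓡 n) (γ a) (γ b)]
  refine (riemannianEDist_le_pathELength hγ1 rfl rfl hab).trans_eq ?_
  rw [← pathELength_congr hγc, pathELength_eq_lintegral_mfderiv_Ioo,
    pathELength_eq_lintegral_mfderiv_Ioo]
  refine setLIntegral_congr_fun measurableSet_Ioo fun t ht => ?_
  have hγt : MDifferentiableAt 𝓘(ℝ, ℝ) (𝓡 n) γ t :=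
    (hγ1.mdifferentiableOn one_ne_zero t (Ioo_subset_Icc_self ht)).mdifferentiableAt
      (Icc_mem_nhds ht.1 ht.2)
  have hpt : MDifferentiableAt (𝓡 n) (𝓡 n) p (γ t) :=
    hp.isLocalDiffeomorph.mdifferentiable (by simp) _
  rw [mfderiv_comp t hpt hγt]
  exact (hp.enorm_mfderiv (γ t) _).symm

/-- The length of a piecewise `C^1` path bounds the distance between the endpoints of its lifts. -/
theorem IsRiemannianUniversalCovering.edist_le_riemannianLength
    (hp : IsRiemannianUniversalCovering n p) {x y : M} {c : Path x y}
    (hc : IsPiecewiseC1 (n := n) c) {Γ : C(unitInterval, N)} (hΓ : ∀ t, p (Γ t) = c t) :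
    edist (Γ 0) (Γ 1) ≤ riemannianLength n c := by
  obtain ⟨m, t, ht, ht0, htm, hC⟩ := hc
  let γ : ℝ → N := fun s => Γ (projIcc 0 1 zero_le_one s)
  have hγ : Continuous γ := Γ.continuous.comp continuous_projIcc
  have hγc : p ∘ γ = c.extend := by
    ext s; exact hΓ _
  have key : ∀ k ≤ m, edist (γ 0) (γ (t k)) ≤ pathELength (𝓡 n) c.extend 0 (t k) := by
    intro k
    induction k with
    | zero => intro _; simp [ht0]
    | succ k ih =>
      intro hk
      refine (edist_triangle _ (γ (t k)) _).trans ?_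
      rw [← pathELength_add (ht0 ▸ ht (Nat.zero_le k)) (ht k.le_succ)]
      refine add_le_add (ih (by omega)) ?_
      exact hp.edist_le_pathELength (ht k.le_succ) hγ.continuousOn (hC k (by omega))
        (fun s _ => congrFun hγc s)
  have h := key m le_rfl
  rw [htm] at h
  simpa [γ, riemannianLength] using h

end Lifts

/-! ### Monodromy and sheets of coverings -/

section Covering

variable {X E : Type*} [TopologicalSpace X] [TopologicalSpace E] {p : E → X}

/-- The fundamental group of the base acts freely on the fibres of a simply connected covering: a
loop with a closed lift is the image of a null-homotopic loop. -/
theorem IsCoveringMap.eq_one_of_monodromy_eq [SimplyConnectedSpace E] (hp : IsCoveringMap p)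
    {x : X} {e : p ⁻¹' {x}} {g : FundamentalGroup X x} (h : hp.monodromy g e = e) : g = 1 := by
  obtain ⟨e, rfl⟩ := e
  have h1 := hp.map_liftPathQuotient g ⟨e, rfl⟩
  have h2 : hp.liftPathQuotient g ⟨e, rfl⟩ =
      (Path.Homotopic.Quotient.refl e).cast rfl (congrArg Subtype.val h) :=
    Subsingleton.elim _ _
  rw [h2, Path.Homotopic.Quotient.map_cast] at h1
  exact eq_of_heq ((Path.Homotopic.Quotient.cast_heq _ _).symm.trans ((heq_of_eq h1.symm).trans
    (Path.Homotopic.Quotient.cast_heq _ _)))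

theorem IsCoveringMap.surjective_of_pathConnected [Nonempty E] [PathConnectedSpace X]
    (hp : IsCoveringMap p) : Function.Surjective p := by
  intro x
  obtain ⟨e⟩ := ‹Nonempty E›
  let γ := PathConnectedSpace.somePath (p e) x
  refine ⟨hp.liftPath γ e γ.source 1, ?_⟩
  have := congrFun (hp.liftPath_lifts γ e γ.source) 1
  simpa using this

/-- An evenly covered neighbourhood `U` of `x` and its sheets, as pairwise disjoint open sets indexed
by the fibre over `x`, each mapped homeomorphically onto `U` by the covering map. -/
theorem IsCoveringMap.exists_sheets (hp : IsCoveringMap p) (x : X) :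
    ∃ U : Set X, IsOpen U ∧ x ∈ U ∧ ∃ s : p ⁻¹' {x} → OpenPartialHomeomorph E X,
      (∀ z, ⇑(s z) = p ∧ (s z).target = U ∧ z.1 ∈ (s z).source) ∧
      Pairwise fun z w => Disjoint (s z).source (s w).source := by
  rcases isEmpty_or_nonempty (p ⁻¹' {x}) with hemp | hne
  · exact ⟨univ, isOpen_univ, trivial, fun z => hemp.elim z, fun z => hemp.elim z,
      fun z => hemp.elim z⟩
  have := (hp x).1
  let t := (hp x).toTrivialization
  have hx : x ∈ t.baseSet := (hp x).mem_toTrivialization_baseSet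
  have hmem : ∀ z : p ⁻¹' {x}, z.1 ∈ t.source := fun z => t.mem_source.2 (by rw [z.2]; exact hx)
  let q : p ⁻¹' {x} → OpenPartialHomeomorph E X := fun z =>
    { toFun := p
      invFun := fun u => t.toOpenPartialHomeomorph.symm (u, (t z.1).2)
      source := t.source ∩ t ⁻¹' (univ ×ˢ {(t z.1).2})
      target := t.baseSet
      map_source' := fun y hy => t.mem_source.1 hy.1
      map_target' := fun u hu => by
        refine ⟨t.map_target (t.mem_target.2 hu), ?_⟩
        simp [t.apply_symm_apply (x := (u, (t z.1).2)) (t.mem_target.2 hu)]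
      left_inv' := fun y hy => by
        have h2 : (t y).2 = (t z.1).2 := hy.2.2
        rw [← h2, ← t.coe_fst hy.1]
        exact t.toOpenPartialHomeomorph.left_inv hy.1
      right_inv' := fun u hu => t.proj_symm_apply (x := (u, (t z.1).2)) (t.mem_target.2 hu)
      open_source := t.continuousOn_toFun.isOpen_inter_preimage t.open_source
        (isOpen_univ.prod (isOpen_discrete _))
      open_target := t.open_baseSet
      continuousOn_toFun := hp.continuous.continuousOn
      continuousOn_invFun := t.toOpenPartialHomeomorph.continuousOn_symm.comp
        (by fun_prop) (fun u hu => t.mem_target.2 hu) }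
  refine ⟨t.baseSet, t.open_baseSet, hx, q, fun z => ⟨rfl, rfl, hmem z, trivial, rfl⟩, ?_⟩
  intro z w hzw
  refine Set.disjoint_left.2 fun y hyz hyw => hzw ?_
  have h1 : (t z.1).2 = (t w.1).2 := (hyz.2.2 : _ = _).symm.trans hyw.2.2
  refine Subtype.ext (t.injOn (hmem z) (hmem w) (Prod.ext ?_ h1))
  exact (t.coe_fst (hmem z)).trans ((z.2.trans w.2.symm).trans (t.coe_fst (hmem w)).symm)

end Covering

/-! ### The Riemannian density in a chart -/

section Density

variable {n : ℕ} {M : Type u} [MetricSpace M] [ChartedSpace (EuclideanSpace ℝ (Fin n)) M]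
  [RiemannianBundle (fun x : M => TangentSpace (𝓡 n) x)]

/-- No measurability of the density is needed, as Lebesgue measure is s-finite. -/
theorem chartVolume_apply [MeasurableSpace M] [BorelSpace M]
    (φ : OpenPartialHomeomorph M (EuclideanSpace ℝ (Fin n))) {A : Set M} (hA : MeasurableSet A) :
    chartVolume φ A =
      ∫⁻ y in φ.symm ⁻¹' A ∩ φ.target, ENNReal.ofReal (riemannianDensity φ y) := by
  have hmeas : AEMeasurable φ.symm ((volume.restrict φ.target).withDensity
      fun y => ENNReal.ofReal (riemannianDensity φ y)) :=
    (φ.continuousOn_symm.aemeasurable φ.open_target.measurableSet).mono_ac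
      (withDensity_absolutelyContinuous _ _)
  rw [chartVolume, Measure.map_apply_of_aemeasurable hmeas hA, withDensity_apply',
    Measure.restrict_restrict' φ.open_target.measurableSet]

/-- The coordinate vector fields are linearly independent, so that their Gram determinant is
positive. -/
theorem riemannianDensity_pos {φ : OpenPartialHomeomorph M (EuclideanSpace ℝ (Fin n))}
    (hφ : φ ∈ IsManifold.maximalAtlas (𝓡 n) ∞ M) {y : EuclideanSpace ℝ (Fin n)}
    (hy : y ∈ φ.target) : 0 < riemannianDensity φ y := by
  have hsymm : MDifferentiableAt (𝓡 n) (𝓡 n) φ.symm y :=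
    (contMDiffAt_symm_of_mem_maximalAtlas hφ hy).mdifferentiableAt (by simp)
  have hfwd : MDifferentiableAt (𝓡 n) (𝓡 n) φ (φ.symm y) :=
    (contMDiffAt_of_mem_maximalAtlas hφ (φ.map_target hy)).mdifferentiableAt (by simp)
  have hid : (φ ∘ φ.symm) =ᶠ[𝓝 y] id := by
    filter_upwards [φ.open_target.mem_nhds hy] with z hz using φ.right_inv hz
  have hcomp := mfderiv_comp y hfwd hsymm
  rw [hid.mfderiv_eq, mfderiv_id] at hcomp
  have hinj : Function.Injective (mfderiv (𝓡 n) (𝓡 n) φ.symm y) := by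
    intro v w hvw
    have := congrArg (mfderiv (𝓡 n) (𝓡 n) φ (φ.symm y)) hvw
    have hv := DFunLike.congr_fun hcomp v
    have hw := DFunLike.congr_fun hcomp w
    exact (hv.trans this).trans hw.symm
  have hli : LinearIndependent ℝ fun i : Fin n =>
      (mfderiv (𝓡 n) (𝓡 n) φ.symm y (EuclideanSpace.single i (1 : ℝ)) :
        TangentSpace (𝓡 n) (φ.symm y)) := by
    have h1 : LinearIndependent ℝ fun i : Fin n =>
        (EuclideanSpace.single i (1 : ℝ) : EuclideanSpace ℝ (Fin n)) := by
      have := (EuclideanSpace.basisFun (Fin n) ℝ).toBasis.linearIndependent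
      rwa [OrthonormalBasis.coe_toBasis, funext (EuclideanSpace.basisFun_apply (Fin n) ℝ)] at this
    exact h1.map' (mfderiv (𝓡 n) (𝓡 n) φ.symm y).toLinearMap (LinearMap.ker_eq_bot.2 hinj)
  exact Real.sqrt_pos.2 (Matrix.posDef_gram_of_linearIndependent hli).det_pos

theorem continuousOn_riemannianDensity [IsManifold (𝓡 n) ∞ M]
    [IsContinuousRiemannianBundle (EuclideanSpace ℝ (Fin n))
      (fun x : M => TangentSpace (𝓡 n) x)]
    {φ : OpenPartialHomeomorph M (EuclideanSpace ℝ (Fin n))}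
    (hφ : φ ∈ IsManifold.maximalAtlas (𝓡 n) ∞ M) :
    ContinuousOn (riemannianDensity φ) φ.target := by
  have h1 : ContinuousOn (tangentMapWithin (𝓡 n) (𝓡 n) φ.symm φ.target)
      (π (EuclideanSpace ℝ (Fin n)) (TangentSpace (𝓡 n)) ⁻¹' φ.target) :=
    (contMDiffOn_symm_of_mem_maximalAtlas hφ).continuousOn_tangentMapWithin (by simp)
      φ.open_target.uniqueMDiffOn
  have h2 : ∀ i : Fin n, ContinuousOn (fun y => (⟨φ.symm y,
      mfderiv (𝓡 n) (𝓡 n) φ.symm y (EuclideanSpace.single i (1 : ℝ))⟩ :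
        TotalSpace (EuclideanSpace ℝ (Fin n)) (fun x : M => TangentSpace (𝓡 n) x))) φ.target := by
    intro i
    have h3 : Continuous fun y : EuclideanSpace ℝ (Fin n) =>
        (⟨y, EuclideanSpace.single i (1 : ℝ)⟩ : TangentBundle (𝓡 n) (EuclideanSpace ℝ (Fin n))) :=
      (tangentBundleModelSpaceHomeomorph (𝓡 n)).symm.continuous.comp
        (f := fun y : EuclideanSpace ℝ (Fin n) =>
          ((y, EuclideanSpace.single i (1 : ℝ)) : ModelProd _ _))
        (continuous_id.prodMk continuous_const)
    refine (h1.comp h3.continuousOn (fun y hy => hy)).congr fun y hy => ?_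
    simp only [Function.comp_apply, tangentMapWithin]
    rw [mfderivWithin_of_mem_nhds (φ.open_target.mem_nhds hy)]
  refine Real.continuous_sqrt.comp_continuousOn ?_
  refine Continuous.comp_continuousOn (g := Matrix.det) (continuous_id.matrix_det) ?_
  refine continuousOn_pi.2 fun i => continuousOn_pi.2 fun j => ?_
  exact ContinuousOn.inner_bundle (h2 i) (h2 j)

end Density

/-! ### Volume of balls in the universal covering -/

section Covering

variable {n : ℕ} {N M : Type u} [MetricSpace N] [ChartedSpace (EuclideanSpace ℝ (Fin n)) N]
  [RiemannianBundle (fun x : N => TangentSpace (𝓡 n) x)]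
  [MetricSpace M] [ChartedSpace (EuclideanSpace ℝ (Fin n)) M]
  [RiemannianBundle (fun x : M => TangentSpace (𝓡 n) x)] {p : N → M}

/-- On a sheet over a set which contains the ball of radius `ε` around `x`, the points over this ball
have distance less than `ε` from the point over `x`: a short path from `x` stays in the ball, and
the inverse of the sheet lifts it. -/
theorem IsRiemannianUniversalCovering.edist_lt_of_sheet
    [IsRiemannianManifold (𝓡 n) N] [IsRiemannianManifold (𝓡 n) M]
    (hp : IsRiemannianUniversalCovering n p) (s : OpenPartialHomeomorph N M) (hs : ⇑s = p)
    {x : M} {ε : ℝ≥0∞} (hε : Metric.eball x ε ⊆ s.target) {z w : N} (hz : z ∈ s.source)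
    (hzx : p z = x) (hw : w ∈ s.source) (hwx : p w ∈ Metric.eball x ε) : edist z w < ε := by
  rw [Metric.mem_eball, edist_comm, IsRiemannianManifold.out (I := 𝓡 n) x (p w)] at hwx
  obtain ⟨γ, h0, h1, hγ, hlt⟩ := exists_lt_of_riemannianEDist_lt hwx
  have hmem : ∀ t ∈ Icc (0 : ℝ) 1, γ t ∈ s.target := by
    intro t ht
    refine hε ?_
    rw [Metric.mem_eball, edist_comm, IsRiemannianManifold.out (I := 𝓡 n) x (γ t)]
    refine lt_of_le_of_lt ?_ hlt
    exact (riemannianEDist_le_pathELength (hγ.mono (Icc_subset_Icc_right ht.2)) h0 rfl ht.1).trans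
      (pathELength_mono le_rfl ht.2)
  have h2 := hp.edist_le_pathELength (γ := s.symm ∘ γ) zero_le_one
    (s.continuousOn_symm.comp hγ.continuousOn hmem) hγ
    (fun t ht => by rw [← hs]; exact s.right_inv (hmem t ht))
  have e0 : (s.symm ∘ γ) 0 = z := by
    rw [Function.comp_apply, h0, ← hzx, ← hs, s.left_inv hz]
  have e1 : (s.symm ∘ γ) 1 = w := by
    rw [Function.comp_apply, h1, ← hs, s.left_inv hw]
  rw [e0, e1] at h2
  exact h2.trans_lt hlt

variable [IsManifold (𝓡 n) ∞ N]

/-- Charts of the base, pulled back to a sheet, are charts of the covering. -/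
theorem IsRiemannianUniversalCovering.trans_mem_maximalAtlas
    (hp : IsRiemannianUniversalCovering n p) (s : OpenPartialHomeomorph N M) (hs : ⇑s = p)
    {φ : OpenPartialHomeomorph M (EuclideanSpace ℝ (Fin n))}
    (hφ : φ ∈ IsManifold.maximalAtlas (𝓡 n) ∞ M) :
    s.trans φ ∈ IsManifold.maximalAtlas (𝓡 n) ∞ N := by
  apply OpenPartialHomeomorph.mem_maximalAtlas_of_contMDiffOn
  · refine (contMDiffOn_of_mem_maximalAtlas hφ).comp
      (hp.isLocalDiffeomorph.contMDiff.contMDiffOn.congr fun y _ => congrFun hs y) ?_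
    intro y hy
    rw [s.trans_source] at hy
    exact hy.2
  · have h1 : ContMDiffOn (𝓡 n) (𝓡 n) (⊤ : ℕ∞) s.symm s.target := by
      refine hp.isLocalDiffeomorph.contMDiffOn_of_comp s.continuousOn_symm ?_
      refine contMDiffOn_id.congr fun u hu => ?_
      rw [← hs]; exact s.right_inv hu
    refine h1.comp ((contMDiffOn_symm_of_mem_maximalAtlas hφ).mono fun y hy => ?_) fun y hy => ?_
    · rw [s.trans_target] at hy; exact hy.1
    · rw [s.trans_target] at hy; exact hy.2

/-- The volume densities of a chart and of its pull-back to a sheet agree, as the covering map is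
a local isometry. -/
theorem IsRiemannianUniversalCovering.riemannianDensity_trans
    (hp : IsRiemannianUniversalCovering n p) (s : OpenPartialHomeomorph N M) (hs : ⇑s = p)
    {φ : OpenPartialHomeomorph M (EuclideanSpace ℝ (Fin n))}
    (hφ : φ ∈ IsManifold.maximalAtlas (𝓡 n) ∞ M) {y : EuclideanSpace ℝ (Fin n)}
    (hy : y ∈ (s.trans φ).target) :
    riemannianDensity (s.trans φ) y = riemannianDensity φ y := by
  have hev : p ∘ (s.trans φ).symm =ᶠ[𝓝 y] φ.symm := by
    filter_upwards [(s.trans φ).open_target.mem_nhds hy] with z hz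
    rw [s.trans_target] at hz
    rw [← hs]
    exact s.right_inv hz.2
  have hsymm : MDifferentiableAt (𝓡 n) (𝓡 n) (s.trans φ).symm y :=
    (contMDiffAt_symm_of_mem_maximalAtlas (hp.trans_mem_maximalAtlas s hs hφ)
      hy).mdifferentiableAt (by simp)
  have hpd : MDifferentiableAt (𝓡 n) (𝓡 n) p ((s.trans φ).symm y) :=
    hp.isLocalDiffeomorph.mdifferentiable (by simp) _
  -- The two inner products live on the tangent spaces at points which are only propositionally equal.
  have hbase : ∀ {a b : M} (_ : a = b) (v w : EuclideanSpace ℝ (Fin n)),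
      @inner ℝ (TangentSpace (𝓡 n) a) _ v w = @inner ℝ (TangentSpace (𝓡 n) b) _ v w := by
    rintro a _ rfl v w; rfl
  have hL : mfderiv (𝓡 n) (𝓡 n) φ.symm y =
      (mfderiv (𝓡 n) (𝓡 n) p ((s.trans φ).symm y)).comp
        (mfderiv (𝓡 n) (𝓡 n) (s.trans φ).symm y) :=
    hev.mfderiv_eq.symm.trans (mfderiv_comp y hpd hsymm)
  unfold riemannianDensity
  congr 3
  ext i j
  rw [← hp.inner_mfderiv]
  rw [hL]
  exact hbase hev.self_of_nhds _ _

variable [IsRiemannianManifold (𝓡 n) N] [IsRiemannianManifold (𝓡 n) M]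

/-- Every point of the fibre over `x` accounts for the same positive amount of volume within
distance `1` from it, and these volumes sit on disjoint sheets. So the volume of a ball of radius
`R + 1` bounds the number of points of the fibre within distance `R` from its centre. -/
theorem IsRiemannianUniversalCovering.exists_volume_ball_ge
    [IsManifold (𝓡 n) ∞ M] [MeasurableSpace N] [BorelSpace N]
    [IsContinuousRiemannianBundle (EuclideanSpace ℝ (Fin n))
      (fun x : M => TangentSpace (𝓡 n) x)]
    (hp : IsRiemannianUniversalCovering n p) (x : M) :
    ∃ v : ℝ≥0∞, v ≠ 0 ∧ ∀ (S : Finset (p ⁻¹' {x})) (e : N) (R : ℝ),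
      (∀ z ∈ S, dist e z ≤ R) → S.card * v ≤ riemannianVolume n N (Metric.ball e (R + 1)) := by
  obtain ⟨U, hU, hxU, s, hs, hdisj⟩ := hp.isCoveringMap.exists_sheets x
  let φ := chartAt (EuclideanSpace ℝ (Fin n)) x
  have hφ : φ ∈ IsManifold.maximalAtlas (𝓡 n) ∞ M := IsManifold.chart_mem_maximalAtlas x
  obtain ⟨ε, hε0, hεU⟩ := EMetric.mem_nhds_iff.1 (hU.mem_nhds hxU)
  let B : Set M := Metric.eball x (min ε 1)
  have hB : IsOpen B := Metric.isOpen_eball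
  have hxB : x ∈ B := Metric.mem_eball_self (lt_min hε0 one_pos)
  have hBU : B ⊆ U := (Metric.eball_subset_eball (min_le_left _ _)).trans hεU
  have hy : φ x ∈ φ.target := φ.map_source (mem_chart_source _ x)
  have hd := riemannianDensity_pos hφ hy
  set d := riemannianDensity φ (φ x) with hd_def
  have hW : ∀ᶠ y in 𝓝 (φ x), y ∈ φ.target ∧ φ.symm y ∈ B ∧ d / 2 < riemannianDensity φ y := by
    refine Filter.Eventually.and (φ.open_target.mem_nhds hy) (Filter.Eventually.and ?_ ?_)
    · refine (φ.continuousAt_symm hy).eventually (hB.mem_nhds ?_)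
      rwa [φ.left_inv (mem_chart_source _ x)]
    · exact ((continuousOn_riemannianDensity hφ).continuousAt
        (φ.open_target.mem_nhds hy)).eventually (lt_mem_nhds (half_lt_self hd))
  -- The amount of volume is that of `φ.symm '' W`, on which the density is bounded from below.
  obtain ⟨W, hWsub, hWopen, hxW⟩ := mem_nhds_iff.1 hW
  refine ⟨∫⁻ y in W, ENNReal.ofReal (riemannianDensity φ y), ?_, ?_⟩
  · have h1 : ENNReal.ofReal (d / 2) * volume W ≤
        ∫⁻ y in W, ENNReal.ofReal (riemannianDensity φ y) := by
      rw [← setLIntegral_const]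
      exact setLIntegral_mono' hWopen.measurableSet fun y hyW =>
        ENNReal.ofReal_le_ofReal (hWsub hyW).2.2.le
    refine (lt_of_lt_of_le (ENNReal.mul_pos ?_ ?_) h1).ne'
    · exact (ENNReal.ofReal_pos.2 (half_pos hd)).ne'
    · exact (hWopen.measure_pos volume ⟨_, hxW⟩).ne'
  · intro S e R hS
    let ψ : p ⁻¹' {x} → OpenPartialHomeomorph N (EuclideanSpace ℝ (Fin n)) :=
      fun z => (s z).trans φ
    let A : p ⁻¹' {x} → Set N := fun z => (ψ z).source ∩ ψ z ⁻¹' W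
    have hA : ∀ z, IsOpen (A z) := fun z => (ψ z).isOpen_inter_preimage hWopen
    have hWtarget : ∀ z, W ⊆ (ψ z).target := by
      intro z y hyW
      rw [OpenPartialHomeomorph.trans_target]
      refine ⟨(hWsub hyW).1, ?_⟩
      rw [mem_preimage, (hs z).2.1]
      exact hBU (hWsub hyW).2.1
    have hAs : ∀ z, A z ⊆ (s z).source := fun z w hw => by
      have := hw.1
      rw [OpenPartialHomeomorph.trans_source] at this
      exact this.1
    have hvol : ∀ z, ∫⁻ y in W, ENNReal.ofReal (riemannianDensity φ y) ≤
        riemannianVolume n N (A z) := by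
      intro z
      have hmem := hp.trans_mem_maximalAtlas (s z) (hs z).1 hφ
      refine le_trans ?_ (Measure.le_iff'.1 (le_iSup₂_of_le (ψ z) hmem le_rfl) (A z))
      rw [chartVolume_apply _ (hA z).measurableSet]
      calc ∫⁻ y in W, ENNReal.ofReal (riemannianDensity φ y)
          = ∫⁻ y in W, ENNReal.ofReal (riemannianDensity (ψ z) y) :=
            setLIntegral_congr_fun hWopen.measurableSet fun y hyW => by
              rw [hp.riemannianDensity_trans (s z) (hs z).1 hφ (hWtarget z hyW)]
        _ ≤ _ := by
            refine lintegral_mono_set fun y hyW => ⟨⟨?_, ?_⟩, hWtarget z hyW⟩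
            · exact (ψ z).map_target (hWtarget z hyW)
            · rw [mem_preimage, (ψ z).right_inv (hWtarget z hyW)]; exact hyW
    have hball : ∀ z ∈ S, A z ⊆ Metric.ball e (R + 1) := by
      intro z hz w hw
      have hwB : p w ∈ B := by
        have h1 : φ (p w) ∈ W := by
          have := hw.2
          rwa [mem_preimage, OpenPartialHomeomorph.coe_trans, (hs z).1] at this
        have h2 : p w ∈ φ.source := by
          have := hw.1
          rw [OpenPartialHomeomorph.trans_source, (hs z).1] at this
          exact this.2
        have := (hWsub h1).2.1
        rwa [φ.left_inv h2] at this
      have h3 : edist z.1 w < 1 := (hp.edist_lt_of_sheet (s z) (hs z).1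
        ((hs z).2.1 ▸ hBU) (hs z).2.2 z.2 (hAs z hw) hwB).trans_le (min_le_right _ _)
      have h4 : dist z.1 w < 1 := by
        rwa [edist_dist, ENNReal.ofReal_lt_one] at h3
      rw [Metric.mem_ball, dist_comm]
      exact (dist_triangle _ z.1 _).trans_lt (add_lt_add_of_le_of_lt (hS z hz) h4)
    calc S.card * ∫⁻ y in W, ENNReal.ofReal (riemannianDensity φ y)
        = ∑ _z ∈ S, ∫⁻ y in W, ENNReal.ofReal (riemannianDensity φ y) := by
          rw [Finset.sum_const, nsmul_eq_mul]
      _ ≤ ∑ z ∈ S, riemannianVolume n N (A z) := Finset.sum_le_sum fun z _ => hvol z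
      _ = riemannianVolume n N (⋃ z ∈ S, A z) :=
          (measure_biUnion_finset (fun z _ w _ hzw => (hdisj hzw).mono (hAs z) (hAs w))
            fun z _ => (hA z).measurableSet).symm
      _ ≤ _ := measure_mono (iUnion₂_subset hball)

end Covering

/-! ### Volume entropy and the lengths of independent loops -/

/-- As the Riemannian distance between any two points is finite, they are joined by a path. -/
theorem IsRiemannianManifold.pathConnectedSpace {n : ℕ} {M : Type u} [MetricSpace M] [Nonempty M]
    [ChartedSpace (EuclideanSpace ℝ (Fin n)) M]
    [RiemannianBundle (fun x : M => TangentSpace (𝓡 n) x)] [IsRiemannianManifold (𝓡 n) M] :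
    PathConnectedSpace M where
  nonempty := ‹_›
  joined x y := by
    have h : riemannianEDist (𝓡 n) x y < ⊤ := by
      rw [← IsRiemannianManifold.out (I := 𝓡 n) x y]; exact edist_lt_top x y
    obtain ⟨γ, h0, h1, hγ, -⟩ := exists_lt_of_riemannianEDist_lt h
    exact (JoinedIn.ofLine hγ.continuousOn h0 h1 (subset_univ _)).joined

/-- The difference between `log (1 + 4 / (e ^ (h s) - 1)) / h` and `log (4 / (h s)) / h` tends
to `0` as `s` tends to `0`. -/
theorem tendsto_log_remainder {h : ℝ} (hh : 0 < h) :
    Tendsto (fun s : ℝ => 1 / h * Real.log (h * s / 4 + h * s / (Real.exp (h * s) - 1)))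
      (𝓝[>] 0) (𝓝 0) := by
  have hlin : Tendsto (fun s : ℝ => h * s) (𝓝[>] 0) (𝓝[≠] 0) := by
    refine tendsto_nhdsWithin_iff.2 ⟨?_, ?_⟩
    · have : Continuous fun s : ℝ => h * s := by fun_prop
      simpa using (this.tendsto 0).mono_left (nhdsWithin_le_nhds (s := Ioi 0))
    · filter_upwards [self_mem_nhdsWithin] with s hs
      exact (mul_pos hh hs).ne'
  have hslope : Tendsto (fun u : ℝ => u / (Real.exp u - 1)) (𝓝[≠] 0) (𝓝 1) := by
    have h1 := (Real.hasDerivAt_exp 0).tendsto_slope_zero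
    simp only [zero_add, Real.exp_zero, smul_eq_mul] at h1
    have h2 := h1.inv₀ one_ne_zero
    rw [inv_one] at h2
    refine h2.congr fun u => ?_
    rw [mul_inv, inv_inv, div_eq_mul_inv]
  have h4 : Tendsto (fun s : ℝ => h * s / 4) (𝓝[>] 0) (𝓝 0) := by
    simpa using (hlin.mono_right nhdsWithin_le_nhds).div_const 4
  have h5 := ((h4.add (hslope.comp hlin)).log (by norm_num)).const_mul (1 / h)
  simpa using h5

theorem log_le_of_four_le {h a b : ℝ} (hh : 0 < h) (ha : 0 < a)
    (hab : 4 ≤ (Real.exp (h * a) - 1) * (Real.exp (h * b) - 1)) :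
    1 / h * Real.log (4 / (h * a)) +
      1 / h * Real.log (h * a / 4 + h * a / (Real.exp (h * a) - 1)) ≤ b := by
  have hha : 0 < h * a := mul_pos hh ha
  have hE : 0 < Real.exp (h * a) - 1 := sub_pos.2 (Real.one_lt_exp_iff.2 hha)
  rw [← mul_add, ← Real.log_mul (by positivity) (by positivity), one_div, inv_mul_le_iff₀ hh,
    Real.log_le_iff_le_exp (by positivity)]
  have : 4 / (h * a) * (h * a / 4 + h * a / (Real.exp (h * a) - 1)) =
      1 + 4 / (Real.exp (h * a) - 1) := by
    field_simp
  rw [this]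
  have := (div_le_iff₀' hE).2 hab
  linarith

/-- The sharp inequality behind the estimate. For loops of lengths `ℓ₀`, `ℓ₁` it is equivalent to
`1 / (1 + e ^ (h ℓ₀)) + 1 / (1 + e ^ (h ℓ₁)) ≤ 1 / 2`. -/
theorem HasVolumeEntropy.four_le {n : ℕ} {M : Type u} [MetricSpace M]
    [ChartedSpace (EuclideanSpace ℝ (Fin n)) M] [IsManifold (𝓡 n) ∞ M]
    [RiemannianBundle (fun x : M => TangentSpace (𝓡 n) x)]
    [IsContMDiffRiemannianBundle (𝓡 n) ∞ (EuclideanSpace ℝ (Fin n))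
      (fun x : M => TangentSpace (𝓡 n) x)]
    [IsRiemannianManifold (𝓡 n) M] {h : ℝ} (hh : 0 < h) (hM : HasVolumeEntropy n M h)
    {x : M} {c : Fin 2 → Path x x} (hc : ∀ i, IsPiecewiseC1 (n := n) (c i))
    (hind : HomotopicallyIndependent c) (hfin : ∀ i, riemannianLength n (c i) ≠ ⊤) :
    0 < (riemannianLength n (c 0)).toReal ∧
      4 ≤ (Real.exp (h * (riemannianLength n (c 0)).toReal) - 1) *
        (Real.exp (h * (riemannianLength n (c 1)).toReal) - 1) := by
  obtain ⟨N, _, _, _, _, _, _, _, _, p, y, hp, hvol⟩ := hM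
  have : Nonempty M := ⟨x⟩
  have : Nonempty N := ⟨y⟩
  have : PathConnectedSpace M := IsRiemannianManifold.pathConnectedSpace (n := n)
  have := hp.simplyConnected
  have : IsContinuousRiemannianBundle (EuclideanSpace ℝ (Fin n))
      (fun x : M => TangentSpace (𝓡 n) x) := by
    obtain ⟨g, hg, hgi⟩ := IsContMDiffRiemannianBundle.exists_contMDiff (IB := 𝓡 n) (n := ∞)
      (F := EuclideanSpace ℝ (Fin n)) (E := fun x : M => TangentSpace (𝓡 n) x)
    exact ⟨g, hg.continuous, hgi⟩
  have hcov := hp.isCoveringMap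
  obtain ⟨e, he⟩ := hcov.surjective_of_pathConnected x
  obtain ⟨iso⟩ := hind
  let _ := hcov.fundamentalGroupMulAction x
  obtain ⟨v, hv0, hv⟩ := hp.exists_volume_ball_ge x
  have key := four_le_of_orbit_growth (F := p ⁻¹' {x}) (fun z => z.1)
    (FreeGroup.lift_injective_of_closure_equiv _ iso) (e := ⟨e, he⟩)
    (fun g hg => hcov.eq_one_of_monodromy_eq hg)
    (ℓ := fun i => (riemannianLength n (c i)).toReal)
    (fun i z => by
      have h1 := hp.edist_le_riemannianLength (hc i)
        (Γ := hcov.liftPath (c i) z ((c i).source.trans z.2.symm))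
        (fun t => congrFun (hcov.liftPath_lifts (c i).toContinuousMap z.1 _) t)
      rw [hcov.liftPath_zero] at h1
      rw [dist_edist]
      exact ENNReal.toReal_mono (hfin i) h1) hh.le
    (fun s hs => by
      have hev : ∀ᶠ R in atTop, 0 < R ∧
          0 < Real.log (riemannianVolume n N (Metric.ball y R)).toReal / R ∧
          Real.log (riemannianVolume n N (Metric.ball y R)).toReal / R < s :=
        (eventually_gt_atTop 0).and
          ((hvol.eventually (lt_mem_nhds hh)).and (hvol.eventually (gt_mem_nhds hs)))
      -- Positivity of the quotient, which holds since `0 < h`, will rule out infinite volume.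
      obtain ⟨R₀, hR₀⟩ := eventually_atTop.1 hev
      -- `v` could be infinite a priori, so it is replaced by `min v 1`.
      have hv1 : min v 1 ≠ ⊤ := ne_top_of_le_ne_top ENNReal.one_ne_top (min_le_right _ _)
      have hvpos : 0 < (min v 1).toReal :=
        ENNReal.toReal_pos (by simp [hv0]) hv1
      refine ⟨Real.exp (s * (1 + dist e y + |R₀|)) / (min v 1).toReal, fun R S hR hS => ?_⟩
      set R' := R + (1 + dist e y + |R₀|) with hR'
      obtain ⟨hpos, hlow, hup⟩ := hR₀ R' (by
        have := le_abs_self R₀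
        have := dist_nonneg (x := e) (y := y)
        linarith)
      rw [div_lt_iff₀ hpos] at hup
      have hlog := (div_pos_iff_of_pos_right hpos).1 hlow
      -- An infinite volume would have `toReal` and logarithm zero.
      have hne : riemannianVolume n N (Metric.ball y R') ≠ ⊤ := by
        intro htop
        simp [htop] at hlog
      have h1 : S.card * min v 1 ≤ riemannianVolume n N (Metric.ball y R') := by
        refine (mul_le_mul_right (min_le_left v 1) _).trans ((hv S e R hS).trans
          (measure_mono (Metric.ball_subset_ball' ?_)))
        have := abs_nonneg R₀
        linarith
      have h2 := ENNReal.toReal_mono hne h1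
      rw [ENNReal.toReal_mul, ENNReal.toReal_natCast] at h2
      have h3 : (riemannianVolume n N (Metric.ball y R')).toReal ≤ Real.exp (s * R') :=
        (Real.le_exp_log _).trans (Real.exp_le_exp.2 hup.le)
      rw [div_mul_eq_mul_div, le_div_iff₀ hvpos, ← Real.exp_add]
      refine (h2.trans h3).trans_eq ?_
      congr 1
      rw [hR']; ring)
  refine ⟨?_, key.2.2⟩
  have := key.1
  rw [Real.exp_lt_one_iff, neg_lt_zero] at this
  exact pos_of_mul_pos_right this hh.le

theorem corollary3 (h : ℝ) (hh : 0 < h) :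
    ∃ r : ℝ → ℝ, r =o[𝓝[>] (0 : ℝ)] (fun _ => (1 : ℝ)) ∧ ∃ δ : ℝ, 0 < δ ∧
      ∀ (n : ℕ) (M : Type u) [MetricSpace M] [CompleteSpace M]
        [ChartedSpace (EuclideanSpace ℝ (Fin n)) M] [IsManifold (𝓡 n) ∞ M]
        [RiemannianBundle (fun x : M => TangentSpace (𝓡 n) x)]
        [IsContMDiffRiemannianBundle (𝓡 n) ∞ (EuclideanSpace ℝ (Fin n))
          (fun x : M => TangentSpace (𝓡 n) x)]
        [IsRiemannianManifold (𝓡 n) M],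
        HasVolumeEntropy n M h →
        ∀ (x : M) (c₁ c₂ : Path x x),
          IsPiecewiseC1 (n := n) c₁ → IsPiecewiseC1 (n := n) c₂ →
          HomotopicallyIndependent ![c₁, c₂] →
          riemannianLength n c₁ < ENNReal.ofReal δ →
          ENNReal.ofReal (1 / h * Real.log (4 / (h * (riemannianLength n c₁).toReal)) +
              r (riemannianLength n c₁).toReal) ≤ riemannianLength n c₂ := by
  refine ⟨fun s => 1 / h * Real.log (h * s / 4 + h * s / (Real.exp (h * s) - 1)),
    (isLittleO_one_iff ℝ).2 (tendsto_log_remainder hh), 1, one_pos, ?_⟩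
  intro n M _ _ _ _ _ _ _ hM x c₁ c₂ hc₁ hc₂ hind hlt
  rcases eq_or_ne (riemannianLength n c₂) ⊤ with htop | hfin
  · rw [htop]; exact le_top
  have key := hM.four_le hh (c := ![c₁, c₂]) (Fin.forall_fin_two.2 ⟨hc₁, hc₂⟩) hind
    (Fin.forall_fin_two.2 ⟨hlt.ne_top, hfin⟩)
  exact ENNReal.ofReal_le_of_le_toReal (log_le_of_four_le hh key.1 key.2)
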